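/- Let $\mathbb{F}$ be an arbitrary field with algebraic closure $\overline{\mathbb{F}}$, let $d\ge 0$ be an integer, let $P(\lambda)\in\mathbb{F}[\lambda]^{m\times n}$ be a polynomial matrix of degree at most $d$, and let $r$ be an integer with $0<r\le\min\{m,n\}$. Conventions. The degree of a polynomial vector or matrix is the highest degree of its entries, with $\deg 0=-\infty$. The normal rank of $P$ is its rank over the field $\mathbb{F}(\lambda)$ of rational functions. If $P$ has normal rank $\rho$, its invariant polynomials are the monic polynomials $e_1\mid e_2\mid\cdots\mid e_\rho$ such that $P=U\,\mathrm{diag}(e_1,\dots,e_\rho,0,\dots,0)\,V$ (the middle factor being $m\times n$) with $U\in\mathbb{F}[\lambda]^{m\times m}$, $V\in\mathbb{F}[\lambda]^{n\times n}$ unimodular, i.e. with constant nonzero determinant. A finite eigenvalue of $P$ is a $\beta\in\overline{\mathbb{F}}$ that is a root of some $e_j$; $P$, as a polynomial matrix of degree at most $d$, has an eigenvalue at infinity (an infinite eigenvalue) if $0$ is a finite eigenvalue of $\lambda^dP(1/\lambda)$. Polynomial vectors form a minimal basis if they are linearly independent over $\mathbb{F}(\lambda)$ and the sum of their degrees is minimal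 among all bases, consisting of polynomial vectors, of the $\mathbb{F}(\lambda)$-subspace they span. Then $P(\lambda)$ has normal rank $r$, degree exactly $d$, and no finite or infinite eigenvalues if and only if $P(\lambda)$ can be factorized as $$P(\lambda)=L(\lambda)R(\lambda),\qquad L(\lambda)\in\mathbb{F}[\lambda]^{m\times r},\quad R(\lambda)\in\mathbb{F}[\lambda]^{r\times n},$$ where the columns of $L(\lambda)$ form a minimal basis, the rows of $R(\lambda)$ form a minimal basis, and $$\deg(L_{*i})+\deg(R_{i*})=d\quad\text{for } i=1,\dots,r,$$ where $L_{*i}$ is the $i$th column of $L$ and $R_{i*}$ is the $i$th row of $R$. -/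

import Mathlib

noncomputable section

namespace PolyMat

open Polynomial

variable {F : Type*} [Field F]

/-- Degree of a polynomial vector: the highest degree of its entries, with `deg 0 = ⊥ = -∞`. -/
def vecDegree {ι : Type*} [Fintype ι] (v : ι → F[X]) : WithBot ℕ :=
  Finset.univ.sup fun i => (v i).degree

/-- Degree of a polynomial matrix: the highest degree of its entries, with `deg 0 = ⊥ = -∞`. -/
def matDegree {m n : ℕ} (P : Matrix (Fin m) (Fin n) F[X]) : WithBot ℕ :=
  Finset.univ.sup fun i => Finset.univ.sup fun j => (P i j).degree

/-- Normal rank: the rank over the field of rational functions `F(λ)`. -/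
def normalRank {m n : ℕ} (P : Matrix (Fin m) (Fin n) F[X]) : ℕ :=
  (P.map (algebraMap F[X] (RatFunc F))).rank

/-- Square polynomial matrices with constant nonzero determinant. -/
def IsUnimodular {n : ℕ} (U : Matrix (Fin n) (Fin n) F[X]) : Prop :=
  ∃ c : F, c ≠ 0 ∧ U.det = C c

/-- The `m × n` matrix `diag(e_1, …, e_r)` padded with zeros. -/
def smithMatrix (m n : ℕ) {r : ℕ} (e : Fin r → F[X]) : Matrix (Fin m) (Fin n) F[X] :=
  Matrix.of fun i j => if h : i.val = j.val ∧ i.val < r then e ⟨i.val, h.2⟩ else 0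

/-- `e_1, …, e_r` are the invariant polynomials of `P`: the nonzero diagonal entries of its
Smith form. -/
structure IsInvariantPolynomials {m n r : ℕ} (P : Matrix (Fin m) (Fin n) F[X])
    (e : Fin r → F[X]) : Prop where
  rank_eq : normalRank P = r
  monic : ∀ j, (e j).Monic
  dvd : ∀ i j, i ≤ j → e i ∣ e j
  smith : ∃ (U : Matrix (Fin m) (Fin m) F[X]) (V : Matrix (Fin n) (Fin n) F[X]),
    IsUnimodular U ∧ IsUnimodular V ∧ P = U * smithMatrix m n e * V

/-- `β` in the algebraic closure of `F` is a finite eigenvalue of `P`: it is a root of some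
invariant polynomial of `P`. -/
def IsFiniteEigenvalue {m n : ℕ} (P : Matrix (Fin m) (Fin n) F[X])
    (β : AlgebraicClosure F) : Prop :=
  ∃ (r : ℕ) (e : Fin r → F[X]), IsInvariantPolynomials P e ∧ ∃ j, aeval β (e j) = 0

/-- The reversal `λ^d P(1/λ)` of a polynomial matrix of degree at most `d`
(`reflect d` exchanges the coefficients of `λ^k` and `λ^(d-k)`). -/
def reversal {m n : ℕ} (d : ℕ) (P : Matrix (Fin m) (Fin n) F[X]) :
    Matrix (Fin m) (Fin n) F[X] :=
  P.map (reflect d)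

/-- `P`, regarded as a polynomial matrix of degree at most `d`, has an eigenvalue at `∞`. -/
def HasInfiniteEigenvalue {m n : ℕ} (d : ℕ) (P : Matrix (Fin m) (Fin n) F[X]) : Prop :=
  IsFiniteEigenvalue (reversal d P) 0

/-- A polynomial vector viewed as a vector of rational functions. -/
def toRat {ι : Type*} (v : ι → F[X]) : ι → RatFunc F :=
  fun i => algebraMap F[X] (RatFunc F) (v i)

/-- The polynomial vectors `b_1, …, b_p` form a basis of the rational subspace `V`. -/
structure IsPolynomialBasis {p k : ℕ} (V : Submodule (RatFunc F) (Fin k → RatFunc F))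
    (b : Fin p → Fin k → F[X]) : Prop where
  linearIndependent : LinearIndependent (RatFunc F) fun i => toRat (b i)
  span_eq : Submodule.span (RatFunc F) (Set.range fun i => toRat (b i)) = V

/-- A minimal basis of `V`: a polynomial basis whose sum of degrees is minimal among all
polynomial bases of `V`. -/
structure IsMinimalBasis {p k : ℕ} (V : Submodule (RatFunc F) (Fin k → RatFunc F))
    (b : Fin p → Fin k → F[X]) : Prop where
  isBasis : IsPolynomialBasis V b
  minimal : ∀ b' : Fin p → Fin k → F[X], IsPolynomialBasis V b' →
    ∑ i, vecDegree (b i) ≤ ∑ i, vecDegree (b' i)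

/-- The rows of `M` form a minimal basis of the rational subspace they span. -/
def RowsMinimalBasis {p k : ℕ} (M : Matrix (Fin p) (Fin k) F[X]) : Prop :=
  IsMinimalBasis (Submodule.span (RatFunc F) (Set.range fun i => toRat (M.row i))) M.row

/-- The columns of `M` form a minimal basis of the rational subspace they span. -/
def ColumnsMinimalBasis {k p : ℕ} (M : Matrix (Fin k) (Fin p) F[X]) : Prop :=
  IsMinimalBasis (Submodule.span (RatFunc F) (Set.range fun j => toRat (M.col j))) M.col

end PolyMat

end

noncomputable section

namespace PolyMat

open Polynomial Matrix

variable {F : Type*} [Field F]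

/-! Finite and infinite eigenvalues are both drops of rank. By the Smith form
(`exists_matEquiv_smithMatrix`), specializing `P` along a homomorphism from `F[X]` to a field leaves
a matrix whose rank counts the invariant polynomials that survive (`MatEquiv.rank_map`). The
reversal at `0` is the coefficient matrix `P_d` of `λ^d`, so there is no eigenvalue at infinity
exactly when `P_d` has the normal rank.

Minimal bases enter through Forney's criterion: the rows of `M` form a minimal basis iff `M` is row
reduced (independent leading row coefficients) and has a polynomial right inverse. One direction is
`RowsMinimalBasis.rowReduced` with `RowsMinimalBasis.exists_rightInverse`, the other
`RowReduced.rowsMinimalBasis`.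

If `P = L * R` is a factorization as in the theorem, one-sided inverses give `A * P * B = 1`, an
identity that survives evaluation at every `β`, so the rank never drops. As the degrees are
complementary, `P_d` is the product of the leading coefficient matrices of `L` and `R`. Both have
rank `r`, hence so has `P_d`.

Conversely, without finite eigenvalues the invariant polynomials are all `1`, which again gives `A *
P * B = 1`. Let the columns of `L` be a minimal basis of the column space of `P`; then `P = L * R`
with `R` polynomial and right invertible. The predictable degree property bounds row `i` of `R` by
`d - deg L_{*i}`. Since `P_d` factors through the coefficients of `R` at these bounds and has rank
`r`, the bounds are attained and `R` is row reduced, hence minimal.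

Uniqueness of the Smith form is not needed: nonexistence of eigenvalues is proved for every
admissible choice of invariant polynomials. -/

/-! ### Equivalence of matrices and the Smith normal form -/

/-- `a ⊕ A` as a matrix of one more row and column. -/
def consBlock {S : Type*} [Zero S] {m n : ℕ} (a : S) (A : Matrix (Fin m) (Fin n) S) :
    Matrix (Fin (m + 1)) (Fin (n + 1)) S :=
  Matrix.of (Fin.cons (Fin.cons a 0) fun i => Fin.cons 0 (A i))

section consBlock

variable {S : Type*} {l m n : ℕ}

@[simp] theorem consBlock_zero_zero [Zero S] (a : S) (A : Matrix (Fin m) (Fin n) S) :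
    consBlock a A 0 0 = a := rfl

@[simp] theorem consBlock_zero_succ [Zero S] (a : S) (A : Matrix (Fin m) (Fin n) S) (j : Fin n) :
    consBlock a A 0 j.succ = 0 := rfl

@[simp] theorem consBlock_succ_zero [Zero S] (a : S) (A : Matrix (Fin m) (Fin n) S) (i : Fin m) :
    consBlock a A i.succ 0 = 0 := rfl

@[simp] theorem consBlock_succ_succ [Zero S] (a : S) (A : Matrix (Fin m) (Fin n) S) (i : Fin m)
    (j : Fin n) : consBlock a A i.succ j.succ = A i j := rfl

theorem consBlock_mul [Semiring S] (a b : S) (A : Matrix (Fin l) (Fin m) S)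
    (B : Matrix (Fin m) (Fin n) S) :
    consBlock a A * consBlock b B = consBlock (a * b) (A * B) := by
  ext i j
  cases i using Fin.cases <;> cases j using Fin.cases <;>
    simp [Matrix.mul_apply, Fin.sum_univ_succ]

theorem consBlock_one_one [Semiring S] :
    consBlock (1 : S) (1 : Matrix (Fin n) (Fin n) S) = 1 := by
  ext i j
  cases i using Fin.cases <;> cases j using Fin.cases <;>
    simp [Matrix.one_apply, Fin.succ_ne_zero, (Fin.succ_ne_zero _).symm]

theorem isUnit_consBlock_one [CommRing S] {A : Matrix (Fin n) (Fin n) S} (hA : IsUnit A) :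
    IsUnit (consBlock 1 A) := by
  obtain ⟨u, rfl⟩ := hA
  refine IsUnit.of_mul_eq_one (consBlock 1 (↑u⁻¹ : Matrix (Fin n) (Fin n) S)) ?_
  rw [consBlock_mul]
  simp [consBlock_one_one]

end consBlock

/-- Two matrices are equivalent if they differ by invertible factors on both sides. -/
def MatEquiv {S : Type*} [CommRing S] {m n : ℕ} (P Q : Matrix (Fin m) (Fin n) S) : Prop :=
  ∃ (U : Matrix (Fin m) (Fin m) S) (V : Matrix (Fin n) (Fin n) S),
    IsUnit U ∧ IsUnit V ∧ P = U * Q * V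

namespace MatEquiv

variable {S : Type*} [CommRing S] {m n : ℕ} {P Q R : Matrix (Fin m) (Fin n) S}

theorem refl (P : Matrix (Fin m) (Fin n) S) : MatEquiv P P :=
  ⟨1, 1, isUnit_one, isUnit_one, by simp⟩

theorem trans (h₁ : MatEquiv P Q) (h₂ : MatEquiv Q R) : MatEquiv P R := by
  obtain ⟨U, V, hU, hV, rfl⟩ := h₁
  obtain ⟨U', V', hU', hV', rfl⟩ := h₂
  exact ⟨U * U', V' * V, hU.mul hU', hV'.mul hV, by simp only [Matrix.mul_assoc]⟩

theorem mul_left {U : Matrix (Fin m) (Fin m) S} (hU : IsUnit U) : MatEquiv P (U * P) := by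
  obtain ⟨u, rfl⟩ := hU
  exact ⟨↑u⁻¹, 1, u⁻¹.isUnit, isUnit_one, by simp [← Matrix.mul_assoc]⟩

theorem mul_right {V : Matrix (Fin n) (Fin n) S} (hV : IsUnit V) : MatEquiv P (P * V) := by
  obtain ⟨v, rfl⟩ := hV
  exact ⟨1, ↑v⁻¹, isUnit_one, v⁻¹.isUnit, by simp [Matrix.mul_assoc]⟩

theorem submatrix (σ : Equiv.Perm (Fin m)) (τ : Equiv.Perm (Fin n)) :
    MatEquiv P (P.submatrix σ τ) := by
  have hσ : IsUnit (σ.toPEquiv.toMatrix : Matrix (Fin m) (Fin m) S) := by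
    refine IsUnit.of_mul_eq_one (σ⁻¹.toPEquiv.toMatrix) ?_
    rw [← PEquiv.toMatrix_trans, ← Equiv.toPEquiv_trans]
    ext; simp [Equiv.Perm.inv_def, Matrix.one_apply]
  have hτ : IsUnit (τ.symm.toPEquiv.toMatrix : Matrix (Fin n) (Fin n) S) := by
    refine IsUnit.of_mul_eq_one (τ.toPEquiv.toMatrix) ?_
    rw [← PEquiv.toMatrix_trans, ← Equiv.toPEquiv_trans]
    ext; simp [Matrix.one_apply]
  have := (mul_left (P := P) hσ).trans (mul_right hτ)
  rwa [PEquiv.toMatrix_toPEquiv_mul, PEquiv.mul_toMatrix_toPEquiv] at this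

/-- The entries of `Q` are combinations of those of `P`, because the outer factors are invertible.
This yields the divisibility chain in the Smith form. -/
theorem dvd (h : MatEquiv P Q) {a : S} (ha : ∀ i j, a ∣ P i j) (i : Fin m) (j : Fin n) :
    a ∣ Q i j := by
  obtain ⟨_, _, ⟨u, rfl⟩, ⟨v, rfl⟩, rfl⟩ := h
  have : Q = (↑u⁻¹ : Matrix (Fin m) (Fin m) S) *
      ((u : Matrix (Fin m) (Fin m) S) * Q * (v : Matrix (Fin n) (Fin n) S)) *
      (↑v⁻¹ : Matrix (Fin n) (Fin n) S) := by
    simp [Matrix.mul_assoc]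
  rw [this, Matrix.mul_apply]
  refine Finset.dvd_sum fun x _ => Dvd.dvd.mul_right ?_ _
  rw [Matrix.mul_apply]
  exact Finset.dvd_sum fun y _ => Dvd.dvd.mul_left (ha _ _) _

end MatEquiv

theorem isUnit_updateCol_one {S : Type*} [CommRing S] {n : ℕ} (i : Fin n) (v : Fin n → S)
    (h : v i = 1) : IsUnit ((1 : Matrix (Fin n) (Fin n) S).updateCol i v) := by
  -- By Cramer's rule for the identity matrix, the determinant is `v i`.
  rw [Matrix.isUnit_iff_isUnit_det, ← Matrix.cramer_apply]
  simp [h]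

theorem isUnit_updateRow_one {S : Type*} [CommRing S] {n : ℕ} (i : Fin n) (v : Fin n → S)
    (h : IsUnit (v i)) : IsUnit ((1 : Matrix (Fin n) (Fin n) S).updateRow i v) := by
  rw [Matrix.isUnit_iff_isUnit_det, ← Matrix.det_transpose, ← Matrix.updateCol_transpose,
    Matrix.transpose_one, ← Matrix.cramer_apply]
  simpa using h

theorem isUnit_transvection {S : Type*} [CommRing S] {n : ℕ} {i j : Fin n} (h : i ≠ j) (c : S) :
    IsUnit (transvection i j c) := by
  rw [Matrix.isUnit_iff_isUnit_det, det_transvection_of_ne _ _ h]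
  exact isUnit_one

/-- A nonzero entry of least degree among all matrices equivalent to `P` is swapped into the corner
and scaled to be monic. This minimality replaces an explicit Euclidean elimination. -/
theorem exists_minimal_pivot {m n : ℕ} {P : Matrix (Fin (m + 1)) (Fin (n + 1)) F[X]}
    (hP : P ≠ 0) :
    ∃ Q, MatEquiv P Q ∧ (Q 0 0).Monic ∧
      ∀ Q', MatEquiv P Q' → ∀ i j, (Q' i j).degree < (Q 0 0).degree → Q' i j = 0 := by
  classical
  let s : Set (Matrix (Fin (m + 1)) (Fin (n + 1)) F[X] × Fin (m + 1) × Fin (n + 1)) :=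
    {x | MatEquiv P x.1 ∧ x.1 x.2.1 x.2.2 ≠ 0}
  have hs : s.Nonempty := by
    by_contra h
    refine hP (Matrix.ext fun i j => ?_)
    by_contra h'
    exact h ⟨(P, i, j), MatEquiv.refl P, h'⟩
  let f : Matrix (Fin (m + 1)) (Fin (n + 1)) F[X] × Fin (m + 1) × Fin (n + 1) → WithBot ℕ :=
    fun x => (x.1 x.2.1 x.2.2).degree
  obtain ⟨⟨Q, i, j⟩, ⟨hQ, hne⟩, hmin⟩ : ∃ x ∈ s, ∀ y ∈ s, ¬ f y < f x :=
    ⟨Function.argminOn f s hs, Function.argminOn_mem f s hs,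
      fun y hy => Function.not_lt_argminOn f s hy⟩
  dsimp only at hQ hne
  have hc : IsUnit (Matrix.scalar (Fin (m + 1)) (C (Q i j).leadingCoeff⁻¹)) :=
    (Polynomial.isUnit_C.2 (IsUnit.mk0 _ (inv_ne_zero (leadingCoeff_ne_zero.2 hne)))).map _
  refine ⟨Matrix.scalar (Fin (m + 1)) (C (Q i j).leadingCoeff⁻¹) *
    Q.submatrix (Equiv.swap 0 i) (Equiv.swap 0 j),
    (hQ.trans (.submatrix _ _)).trans (.mul_left hc), ?_, ?_⟩
  · simp only [Matrix.scalar_apply, Matrix.diagonal_mul, Matrix.submatrix_apply,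
      Equiv.swap_apply_left]
    rw [mul_comm]
    exact monic_mul_leadingCoeff_inv hne
  · intro Q' hQ' i' j' h
    by_contra h'
    refine hmin (Q', i', j') ⟨hQ', h'⟩ ?_
    simp only [Matrix.scalar_apply, Matrix.diagonal_mul, Matrix.submatrix_apply,
      Equiv.swap_apply_left] at h
    rwa [mul_comm, degree_mul_leadingCoeff_inv _ hne] at h

/-- A remainder modulo the pivot would be an entry of smaller degree in an equivalent matrix, hence
vanishes. So the pivot divides its row and column, which can be cleared. -/
theorem exists_matEquiv_consBlock {m n : ℕ} {P : Matrix (Fin (m + 1)) (Fin (n + 1)) F[X]}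
    (hP : P ≠ 0) :
    ∃ (a : F[X]) (A : Matrix (Fin m) (Fin n) F[X]),
      a.Monic ∧ (∀ i j, a ∣ A i j) ∧ MatEquiv P (consBlock a A) := by
  obtain ⟨Q, hQ, hmon, hmin⟩ := exists_minimal_pivot hP
  set a := Q 0 0 with ha
  have ha0 : a ≠ 0 := hmon.ne_zero
  have sub_mul_div : ∀ b : F[X], b - a * (b / a) = b % a := fun b =>
    sub_eq_iff_eq_add.2 (EuclideanDomain.mod_add_div _ _).symm
  have hcol : ∀ Q', MatEquiv P Q' → Q' 0 0 = a → ∀ i : Fin m, a ∣ Q' i.succ 0 := by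
    intro Q' h' h0 i
    -- Subtracting the quotient times row `0` leaves the remainder in column `0`.
    have := hmin _ (h'.trans (.mul_left (isUnit_transvection (Fin.succ_ne_zero i)
      (-(Q' i.succ 0 / a))))) i.succ 0
    rw [transvection_mul_apply_same, h0, neg_mul, ← sub_eq_add_neg, mul_comm, sub_mul_div] at this
    exact EuclideanDomain.mod_eq_zero.1 (this (Polynomial.degree_mod_lt _ ha0))
  have hrow : ∀ Q', MatEquiv P Q' → Q' 0 0 = a → ∀ j : Fin n, a ∣ Q' 0 j.succ := by
    intro Q' h' h0 j
    have := hmin _ (h'.trans (.mul_right (isUnit_transvection (Fin.succ_ne_zero j).symm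
      (-(Q' 0 j.succ / a))))) 0 j.succ
    rw [mul_transvection_apply_same, h0, neg_mul, ← sub_eq_add_neg, mul_comm, sub_mul_div] at this
    exact EuclideanDomain.mod_eq_zero.1 (this (Polynomial.degree_mod_lt _ ha0))
  choose c hc using hcol Q hQ rfl
  let E : Matrix (Fin (m + 1)) (Fin (m + 1)) F[X] :=
    (1 : Matrix _ _ F[X]).updateCol 0 (Fin.cons 1 fun i => - c i)
  have hE : IsUnit E := isUnit_updateCol_one _ _ rfl
  have hQ1 : MatEquiv P (E * Q) := hQ.trans (.mul_left hE)
  have hE0 : ∀ j, (E * Q) 0 j = Q 0 j := by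
    intro j
    simp [E, Matrix.mul_apply, Fin.sum_univ_succ, Matrix.updateCol_apply, Matrix.one_apply,
      (Fin.succ_ne_zero _).symm]
  have hE1 : ∀ i : Fin m, (E * Q) i.succ 0 = 0 := by
    intro i
    simp [E, Matrix.mul_apply, Fin.sum_univ_succ, Matrix.updateCol_apply, Matrix.one_apply, hc,
      mul_comm, ← ha]
  choose c' hc' using hrow _ hQ1 (hE0 0)
  let E' : Matrix (Fin (n + 1)) (Fin (n + 1)) F[X] :=
    (1 : Matrix _ _ F[X]).updateRow 0 (Fin.cons 1 fun i => - c' i)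
  have hE' : IsUnit E' := isUnit_updateRow_one _ _ isUnit_one
  have hQ2 : MatEquiv P (E * Q * E') := hQ1.trans (.mul_right hE')
  have hE'0 : ∀ i, (E * Q * E') i 0 = (E * Q) i 0 := by
    intro i
    rw [Matrix.mul_apply]
    simp [E', Fin.sum_univ_succ, Matrix.updateRow_apply, Matrix.one_apply]
  have hE'1 : ∀ j : Fin n, (E * Q * E') 0 j.succ = 0 := by
    intro j
    rw [Matrix.mul_apply, Fin.sum_univ_succ, hE0 0]
    simp [E', Matrix.updateRow_apply, Matrix.one_apply, hc', ← ha]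
  set T := E * Q * E' with hT
  have hT00 : T 0 0 = a := by rw [hE'0, hE0]
  refine ⟨a, T.submatrix Fin.succ Fin.succ, hmon, ?_, ?_⟩
  · intro i j
    -- Adding a lower row to row `0` keeps the pivot, as column `0` is already cleared, and moves
    -- that row of the block to where `hrow` applies.
    have := hrow (transvection 0 i.succ 1 * T)
      (hQ2.trans (.mul_left (isUnit_transvection (Fin.succ_ne_zero i).symm 1)))
      (by rw [transvection_mul_apply_same, hT00, hE'0, hE1]; simp) j
    rw [transvection_mul_apply_same, hE'1] at this
    simpa using this
  · convert hQ2
    ext1 i j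
    cases i using Fin.cases <;> cases j using Fin.cases <;>
      simp [hT00, hE'1, hE'0, hE1]

theorem smithMatrix_cons (m n : ℕ) {r : ℕ} (a : F[X]) (e : Fin r → F[X]) :
    smithMatrix (m + 1) (n + 1) (Fin.cons a e : Fin (r + 1) → F[X]) =
      consBlock a (smithMatrix m n e) := by
  ext1 i j
  cases i using Fin.cases with
  | zero => cases j using Fin.cases <;> simp [smithMatrix]
  | succ i =>
    cases j using Fin.cases with
    | zero => simp [smithMatrix]
    | succ j =>
      by_cases h : i.val = j.val ∧ i.val < r
      · have h' : i.val + 1 = j.val + 1 ∧ i.val + 1 < r + 1 := by omega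
        simp only [smithMatrix, Matrix.of_apply, Fin.val_succ, consBlock_succ_succ, dif_pos h,
          dif_pos h']
        rfl
      · have h' : ¬ (i.val + 1 = j.val + 1 ∧ i.val + 1 < r + 1) := by omega
        simp only [smithMatrix, Matrix.of_apply, Fin.val_succ, consBlock_succ_succ, dif_neg h,
          dif_neg h']

theorem smithMatrix_fin_zero (m n : ℕ) (e : Fin 0 → F[X]) : smithMatrix m n e = 0 := by
  ext1 i j
  simp [smithMatrix]

theorem smithMatrix_castLE {m n r : ℕ} (hm : r ≤ m) (hn : r ≤ n) (e : Fin r → F[X]) (j : Fin r) :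
    smithMatrix m n e (Fin.castLE hm j) (Fin.castLE hn j) = e j := by
  simp [smithMatrix]

/-- Existence of the Smith normal form. -/
theorem exists_matEquiv_smithMatrix {m n : ℕ} (P : Matrix (Fin m) (Fin n) F[X]) :
    ∃ (r : ℕ) (e : Fin r → F[X]), r ≤ m ∧ r ≤ n ∧ (∀ j, (e j).Monic) ∧
      (∀ i j, i ≤ j → e i ∣ e j) ∧ MatEquiv P (smithMatrix m n e) := by
  induction m generalizing n with
  | zero =>
    refine ⟨0, Fin.elim0, le_rfl, Nat.zero_le _, fun j => j.elim0, fun j => j.elim0, ?_⟩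
    rw [Subsingleton.elim (smithMatrix _ _ _) P]
    exact .refl P
  | succ m ih =>
    by_cases hP : P = 0
    · refine ⟨0, Fin.elim0, Nat.zero_le _, Nat.zero_le _, fun j => j.elim0, fun j => j.elim0, ?_⟩
      rw [smithMatrix_fin_zero, hP]
      exact .refl 0
    cases n with
    | zero => exact absurd (Subsingleton.elim P 0) hP
    | succ n =>
      obtain ⟨a, A, ha, hdvd, hPA⟩ := exists_matEquiv_consBlock hP
      obtain ⟨r, e, hm, hn, hmon, hchain, hA⟩ := ih A
      refine ⟨r + 1, Fin.cons a e, by omega, by omega, ?_, ?_, hPA.trans ?_⟩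
      · intro j
        cases j using Fin.cases with
        | zero => simpa using ha
        | succ j => simpa using hmon j
      · intro i j hij
        cases i using Fin.cases with
        | zero =>
          cases j using Fin.cases with
          | zero => exact dvd_rfl
          | succ j =>
            simp only [Fin.cons_zero, Fin.cons_succ]
            rw [← smithMatrix_castLE hm hn e j]
            exact hA.dvd hdvd _ _
        | succ i =>
          cases j using Fin.cases with
          | zero => simp at hij
          | succ j => simpa using hchain i j (by simpa using hij)
      · rw [smithMatrix_cons]
        obtain ⟨U, V, hU, hV, rfl⟩ := hA
        exact ⟨consBlock 1 U, consBlock 1 V, isUnit_consBlock_one hU, isUnit_consBlock_one hV,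
          by simp [consBlock_mul]⟩

/-! ### Invariant polynomials and ranks of specializations -/

theorem isUnimodular_iff_isUnit {n : ℕ} {U : Matrix (Fin n) (Fin n) F[X]} :
    IsUnimodular U ↔ IsUnit U := by
  rw [Matrix.isUnit_iff_isUnit_det, Polynomial.isUnit_iff]
  constructor
  · rintro ⟨c, hc, h⟩
    exact ⟨c, IsUnit.mk0 c hc, h.symm⟩
  · rintro ⟨c, hc, h⟩
    exact ⟨c, hc.ne_zero, h.symm⟩

/-- The first `r` columns of the identity matrix. -/
def firstColumns (S : Type*) [Zero S] [One S] {m r : ℕ} (h : r ≤ m) : Matrix (Fin m) (Fin r) S :=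
  (1 : Matrix (Fin m) (Fin m) S).submatrix id (Fin.castLE h)

theorem firstColumns_transpose_mul_smithMatrix_mul {m n r : ℕ} (hm : r ≤ m) (hn : r ≤ n)
    (e : Fin r → F[X]) :
    (firstColumns F[X] hm)ᵀ * smithMatrix m n e * firstColumns F[X] hn = Matrix.diagonal e := by
  ext1 i j
  have h : ((firstColumns F[X] hm)ᵀ * smithMatrix m n e * firstColumns F[X] hn) i j =
      smithMatrix m n e (Fin.castLE hm i) (Fin.castLE hn j) := by
    simp [firstColumns, Matrix.mul_apply, Matrix.one_apply]
  rw [h]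
  by_cases hij : i = j
  · subst hij
    simp [smithMatrix]
  · have : i.val ≠ j.val := fun h => hij (Fin.ext h)
    simp [smithMatrix, hij, this]

theorem smithMatrix_eq {m n r : ℕ} (hm : r ≤ m) (hn : r ≤ n) (e : Fin r → F[X]) :
    smithMatrix m n e =
      firstColumns F[X] hm * Matrix.diagonal e * (firstColumns F[X] hn)ᵀ := by
  ext1 i j
  rw [Matrix.mul_apply]
  simp only [Matrix.mul_diagonal, firstColumns, smithMatrix, Matrix.of_apply,
    Matrix.submatrix_apply, Matrix.transpose_apply, Matrix.one_apply, id]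
  by_cases h : i.val = j.val ∧ i.val < r
  · rw [dif_pos h, Finset.sum_eq_single ⟨i.val, h.2⟩]
    · have h1 : i = Fin.castLE hm ⟨i.val, h.2⟩ := Fin.ext rfl
      have h2 : j = Fin.castLE hn ⟨i.val, h.2⟩ := Fin.ext h.1.symm
      rw [if_pos h1, if_pos h2]; simp
    · intro x _ hx
      have h1 : i ≠ Fin.castLE hm x := fun hh => hx (Fin.ext (congrArg Fin.val hh).symm)
      rw [if_neg h1]; simp
    · simp
  · rw [dif_neg h, Finset.sum_eq_zero]
    intro x _
    by_cases h1 : i = Fin.castLE hm x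
    · have h2 : j ≠ Fin.castLE hn x := fun hh => h ⟨by rw [h1, hh]; rfl, by rw [h1]; exact x.2⟩
      rw [if_neg h2]; simp
    · rw [if_neg h1]; simp

/-- Rank of the image of a matrix under a ring homomorphism to a field, read off a Smith form. -/
theorem MatEquiv.rank_map {K : Type*} [Field K] (f : F[X] →+* K) {m n r : ℕ} (hm : r ≤ m)
    (hn : r ≤ n) {e : Fin r → F[X]} {P : Matrix (Fin m) (Fin n) F[X]}
    (h : MatEquiv P (smithMatrix m n e)) :
    (P.map f).rank = Nat.card {j // f (e j) ≠ 0} := by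
  classical
  obtain ⟨U, V, hU, hV, rfl⟩ := h
  have hU' : IsUnit (U.map f).det := (Matrix.isUnit_iff_isUnit_det _).1 (hU.map f.mapMatrix)
  have hV' : IsUnit (V.map f).det := (Matrix.isUnit_iff_isUnit_det _).1 (hV.map f.mapMatrix)
  have hd : (Matrix.diagonal e).map f = Matrix.diagonal (fun j => f (e j)) :=
    Matrix.diagonal_map (map_zero f)
  rw [Nat.card_eq_fintype_card, ← Matrix.rank_diagonal, ← hd, Matrix.map_mul, Matrix.map_mul,
    Matrix.rank_mul_eq_left_of_isUnit_det _ _ hV', Matrix.rank_mul_eq_right_of_isUnit_det _ _ hU']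
  apply le_antisymm
  · rw [smithMatrix_eq hm hn, Matrix.map_mul, Matrix.map_mul]
    exact (Matrix.rank_mul_le_left _ _).trans (Matrix.rank_mul_le_right _ _)
  · rw [← firstColumns_transpose_mul_smithMatrix_mul hm hn, Matrix.map_mul, Matrix.map_mul]
    exact (Matrix.rank_mul_le_left _ _).trans (Matrix.rank_mul_le_right _ _)

theorem MatEquiv.rank_map_of_ne_zero {K : Type*} [Field K] (f : F[X] →+* K) {m n r : ℕ}
    (hm : r ≤ m) (hn : r ≤ n) {e : Fin r → F[X]} {P : Matrix (Fin m) (Fin n) F[X]}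
    (h : MatEquiv P (smithMatrix m n e)) (he : ∀ j, f (e j) ≠ 0) : (P.map f).rank = r := by
  rw [h.rank_map f hm hn, Nat.card_congr (Equiv.subtypeUnivEquiv he), Nat.card_fin]

theorem exists_isInvariantPolynomials {m n : ℕ} (P : Matrix (Fin m) (Fin n) F[X]) :
    ∃ e : Fin (normalRank P) → F[X], IsInvariantPolynomials P e := by
  obtain ⟨r, e, hm, hn, hmon, hchain, hP⟩ := exists_matEquiv_smithMatrix P
  have hr : normalRank P = r := hP.rank_map_of_ne_zero _ hm hn fun j =>
    (map_ne_zero_iff _ (IsFractionRing.injective F[X] (RatFunc F))).2 (hmon j).ne_zero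
  subst hr
  obtain ⟨U, V, hU, hV, h⟩ := hP
  exact ⟨e, rfl, hmon, hchain, U, V, isUnimodular_iff_isUnit.2 hU, isUnimodular_iff_isUnit.2 hV, h⟩

theorem IsInvariantPolynomials.matEquiv {m n r : ℕ} {P : Matrix (Fin m) (Fin n) F[X]}
    {e : Fin r → F[X]} (h : IsInvariantPolynomials P e) : MatEquiv P (smithMatrix m n e) := by
  obtain ⟨U, V, hU, hV, h⟩ := h.smith
  exact ⟨U, V, isUnimodular_iff_isUnit.1 hU, isUnimodular_iff_isUnit.1 hV, h⟩

theorem normalRank_le_height {m n : ℕ} (P : Matrix (Fin m) (Fin n) F[X]) : normalRank P ≤ m :=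
  Matrix.rank_le_height _

theorem normalRank_le_width {m n : ℕ} (P : Matrix (Fin m) (Fin n) F[X]) : normalRank P ≤ n :=
  Matrix.rank_le_width _

/-- Monic invariant polynomials survive any injective map, so the rank is the same for all of them.
The case needed is `λ ↦ 1/λ`. -/
theorem rank_map_eq_normalRank {K : Type*} [Field K] (f : F[X] →+* K)
    (hf : Function.Injective f) {m n : ℕ} (P : Matrix (Fin m) (Fin n) F[X]) :
    (P.map f).rank = normalRank P := by
  obtain ⟨e, he⟩ := exists_isInvariantPolynomials P
  exact he.matEquiv.rank_map_of_ne_zero f (normalRank_le_height P) (normalRank_le_width P)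
    fun j => (map_ne_zero_iff f hf).2 (he.monic j).ne_zero

/-- A field-valued specialization that keeps the rank does not kill invariant polynomials. -/
theorem IsInvariantPolynomials.map_ne_zero {K : Type*} [Field K] (f : F[X] →+* K) {m n r : ℕ}
    {P : Matrix (Fin m) (Fin n) F[X]} {e : Fin r → F[X]} (h : IsInvariantPolynomials P e)
    (hr : r ≤ (P.map f).rank) (j : Fin r) : f (e j) ≠ 0 := by
  intro hj
  rw [h.matEquiv.rank_map f (h.rank_eq ▸ normalRank_le_height P)
    (h.rank_eq ▸ normalRank_le_width P)] at hr
  classical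
  have := Fintype.card_subtype_lt (p := fun j => f (e j) ≠ 0) (x := j) (by simpa using hj)
  rw [Fintype.card_fin, ← Nat.card_eq_fintype_card] at this
  omega

/-- A matrix of normal rank `r` without finite eigenvalues has the `r × r` identity as a product
with polynomial factors on both sides. -/
theorem exists_mul_mul_eq_one {m n r : ℕ} {P : Matrix (Fin m) (Fin n) F[X]}
    (hr : normalRank P = r) (h : ∀ β, ¬ IsFiniteEigenvalue P β) :
    ∃ (A : Matrix (Fin r) (Fin m) F[X]) (B : Matrix (Fin n) (Fin r) F[X]), A * P * B = 1 := by
  subst hr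
  obtain ⟨e, he⟩ := exists_isInvariantPolynomials P
  have he1 : e = 1 := by
    funext j
    by_contra hj
    -- A monic polynomial other than `1` is nonconstant, so it has a root in the algebraic closure.
    have hdeg : (e j).degree ≠ 0 := fun h0 => hj ((he.monic j).degree_le_zero_iff_eq_one.1 h0.le)
    obtain ⟨β, hβ⟩ := IsAlgClosed.exists_aeval_eq_zero (AlgebraicClosure F) (e j) hdeg
    exact h β ⟨_, e, he, j, hβ⟩
  obtain ⟨_, _, ⟨u, rfl⟩, ⟨v, rfl⟩, hP⟩ := he.matEquiv
  have key := firstColumns_transpose_mul_smithMatrix_mul (normalRank_le_height P)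
    (normalRank_le_width P) e
  refine ⟨(firstColumns F[X] (normalRank_le_height P))ᵀ * (↑u⁻¹ : Matrix (Fin m) (Fin m) F[X]),
    (↑v⁻¹ : Matrix (Fin n) (Fin n) F[X]) * firstColumns F[X] (normalRank_le_width P), ?_⟩
  have hS : (↑u⁻¹ : Matrix (Fin m) (Fin m) F[X]) * P * (↑v⁻¹ : Matrix (Fin n) (Fin n) F[X]) =
      smithMatrix m n e := by
    conv_lhs => rw [hP]
    simp [Matrix.mul_assoc]
  rw [← hS, he1] at key
  calc _ = (firstColumns F[X] (normalRank_le_height P))ᵀ *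
      ((↑u⁻¹ : Matrix (Fin m) (Fin m) F[X]) * P * (↑v⁻¹ : Matrix (Fin n) (Fin n) F[X])) *
      firstColumns F[X] (normalRank_le_width P) := by
        simp only [Matrix.mul_assoc]
    _ = Matrix.diagonal 1 := key
    _ = 1 := Matrix.diagonal_one

/-! ### Reversal and the coefficient matrix of degree `d` -/

theorem reversal_map_evalRingHom_zero {m n : ℕ} (d : ℕ) (P : Matrix (Fin m) (Fin n) F[X]) :
    (reversal d P).map (evalRingHom 0) = P.map fun p => p.coeff d := by
  ext i j
  simp [reversal, ← coeff_zero_eq_eval_zero, coeff_reflect, revAt_le (Nat.zero_le d)]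

theorem natDegree_le_of_matDegree_le {m n d : ℕ} {P : Matrix (Fin m) (Fin n) F[X]}
    (h : matDegree P ≤ d) (i : Fin m) (j : Fin n) : (P i j).natDegree ≤ d := by
  rw [matDegree, Finset.sup_le_iff] at h
  exact natDegree_le_iff_degree_le.2 (Finset.sup_le_iff.1 (h i (Finset.mem_univ i)) j
    (Finset.mem_univ j))

/-- The reversal is `P(1/λ)` times the nonzero scalar `λ^d`, and substituting `1/λ` is an injective
homomorphism. -/
theorem normalRank_reversal {m n d : ℕ} {P : Matrix (Fin m) (Fin n) F[X]}
    (h : matDegree P ≤ d) : normalRank (reversal d P) = normalRank P := by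
  have hX : (RatFunc.X : RatFunc F) ≠ 0 := RatFunc.X_ne_zero
  let x : RatFunc F := RatFunc.X
  let _ : Invertible x⁻¹ := invertibleOfNonzero (inv_ne_zero hX)
  have hinv : ⅟x⁻¹ = x := by simp
  let f : F[X] →+* RatFunc F := eval₂RingHom (algebraMap F (RatFunc F)) x⁻¹
  have key : ∀ (N : ℕ) (p : F[X]), p.natDegree ≤ N →
      algebraMap F[X] (RatFunc F) (reflect N p) = x ^ N * f p := by
    intro N p hp
    have := eval₂_reflect_mul_pow (algebraMap F (RatFunc F)) x⁻¹ N p hp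
    rw [hinv] at this
    have hx : eval₂ (algebraMap F (RatFunc F)) x (reflect N p) =
        algebraMap F[X] (RatFunc F) (reflect N p) := by
      rw [← aeval_def, show x = algebraMap F[X] (RatFunc F) X from RatFunc.algebraMap_X.symm,
        aeval_algebraMap_apply, aeval_X_left_apply]
    rw [hx] at this
    change _ = x ^ N * eval₂ _ _ p
    rw [← this, mul_comm (x ^ N), mul_assoc, ← mul_pow, inv_mul_cancel₀ hX, one_pow, mul_one]
  have hf : Function.Injective f := by
    rw [injective_iff_map_eq_zero]
    intro p hp
    have := key p.natDegree p le_rfl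
    rw [hp, mul_zero, FaithfulSMul.algebraMap_eq_zero_iff, reflect_eq_zero_iff] at this
    exact this
  rw [← rank_map_eq_normalRank f hf P, ← Matrix.rank_smul_of_mem_nonZeroDivisors (P.map f)
    (mem_nonZeroDivisors_of_ne_zero (pow_ne_zero d hX)), normalRank]
  congr 1
  ext i j
  exact key d _ (natDegree_le_of_matDegree_le h i j)

/-! ### Row degrees and row reduced matrices -/

/-- Highest degree of the entries of a polynomial vector, with value `0` at the zero vector. -/
def vecNatDegree {k : ℕ} (v : Fin k → F[X]) : ℕ := Finset.univ.sup fun j => (v j).natDegree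

theorem natDegree_le_vecNatDegree {k : ℕ} (v : Fin k → F[X]) (j : Fin k) :
    (v j).natDegree ≤ vecNatDegree v :=
  Finset.le_sup (f := fun j => (v j).natDegree) (Finset.mem_univ j)

theorem vecNatDegree_le {k N : ℕ} {v : Fin k → F[X]} (h : ∀ j, (v j).natDegree ≤ N) :
    vecNatDegree v ≤ N :=
  Finset.sup_le fun j _ => h j

theorem degree_le_vecDegree {k : ℕ} (v : Fin k → F[X]) (j : Fin k) :
    (v j).degree ≤ vecDegree v :=
  Finset.le_sup (f := fun j => (v j).degree) (Finset.mem_univ j)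

theorem vecDegree_eq_coe {k : ℕ} {v : Fin k → F[X]} (hv : v ≠ 0) :
    vecDegree v = (vecNatDegree v : WithBot ℕ) := by
  apply le_antisymm
  · exact Finset.sup_le fun j _ => natDegree_le_iff_degree_le.1 (natDegree_le_vecNatDegree v j)
  · obtain ⟨j₀, hj₀⟩ := Function.ne_iff.1 hv
    obtain ⟨j, -, hj⟩ := Finset.exists_mem_eq_sup Finset.univ ⟨j₀, Finset.mem_univ j₀⟩
      fun j => (v j).natDegree
    rw [vecNatDegree, hj]
    by_cases h0 : v j = 0
    · rw [h0, natDegree_zero]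
      exact (zero_le_degree_iff.2 hj₀).trans (degree_le_vecDegree v j₀)
    · rw [← degree_eq_natDegree h0]
      exact degree_le_vecDegree v j

/-- The matrix of coefficients of degree `l i` in row `i`. -/
def rowCoeff {p k : ℕ} (M : Matrix (Fin p) (Fin k) F[X]) (l : Fin p → ℕ) :
    Matrix (Fin p) (Fin k) F :=
  Matrix.of fun i j => (M i j).coeff (l i)

/-- The matrix of leading row coefficients has linearly independent rows. -/
def RowReduced {p k : ℕ} (M : Matrix (Fin p) (Fin k) F[X]) : Prop :=
  LinearIndependent F (rowCoeff M fun i => vecNatDegree (M i)).row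

theorem RowReduced.row_ne_zero {p k : ℕ} {M : Matrix (Fin p) (Fin k) F[X]} (h : RowReduced M)
    (i : Fin p) : M i ≠ 0 := by
  intro h0
  refine h.ne_zero i (funext fun j => ?_)
  simp [rowCoeff, Matrix.row, h0]

/-- Coefficients of a product of matrices with complementary degree bounds. -/
theorem map_coeff_mul {m n r d : ℕ} {L : Matrix (Fin m) (Fin r) F[X]}
    {R : Matrix (Fin r) (Fin n) F[X]} {k l : Fin r → ℕ} (hL : ∀ a i, (L a i).natDegree ≤ k i)
    (hR : ∀ i b, (R i b).natDegree ≤ l i) (hkl : ∀ i, k i + l i = d) :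
    (L * R).map (fun p => p.coeff d) = (rowCoeff Lᵀ k)ᵀ * rowCoeff R l := by
  ext a b
  simp only [Matrix.map_apply, Matrix.mul_apply, finsetSum_coeff, rowCoeff,
    Matrix.transpose_apply, Matrix.of_apply]
  refine Finset.sum_congr rfl fun i _ => ?_
  rw [← hkl i]
  exact coeff_mul_add_eq_of_natDegree_le (hL a i) (hR i b)

/-- The predictable degree property of row reduced matrices. -/
theorem RowReduced.natDegree_add_le {p k : ℕ} {M : Matrix (Fin p) (Fin k) F[X]}
    (h : RowReduced M) (c : Fin p → F[X]) (i : Fin p) (hi : c i ≠ 0) :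
    (c i).natDegree + vecNatDegree (M i) ≤ vecNatDegree (c ᵥ* M) := by
  classical
  -- Indices with `c i = 0` must be left out: `natDegree 0 = 0` would let them contribute
  -- `vecNatDegree (M i)` to the maximum.
  let s : Finset (Fin p) := Finset.univ.filter fun i => c i ≠ 0
  obtain ⟨i₀, hi₀, hmax⟩ := s.exists_max_image (fun i => (c i).natDegree + vecNatDegree (M i))
    ⟨i, by simpa [s] using hi⟩
  have hi₀' : c i₀ ≠ 0 := by simpa [s] using hi₀
  refine (hmax i (by simpa [s] using hi)).trans ?_
  by_contra! hlt
  set N := (c i₀).natDegree + vecNatDegree (M i₀) with hN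
  -- If the top degree `N` cancelled in `c ᵥ* M`, its coefficient would be a vanishing combination
  -- of leading rows, with the leading coefficient of `c i₀` at `i₀`.
  have hz : ∑ i, (if c i = 0 then 0 else (c i).coeff (N - vecNatDegree (M i))) •
      (rowCoeff M fun i => vecNatDegree (M i)).row i = 0 := by
    funext j
    have h0 : ((c ᵥ* M) j).coeff N = 0 :=
      coeff_eq_zero_of_natDegree_lt ((natDegree_le_vecNatDegree _ j).trans_lt hlt)
    rw [Matrix.vecMul, dotProduct, finsetSum_coeff] at h0
    rw [Finset.sum_apply, Pi.zero_apply]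
    refine (Finset.sum_congr rfl fun i _ => ?_).trans h0
    by_cases hci : c i = 0
    · simp [hci]
    · have hle : (c i).natDegree + vecNatDegree (M i) ≤ N := hmax i (by simpa [s] using hci)
      have hsub : N = (N - vecNatDegree (M i)) + vecNatDegree (M i) := by omega
      rw [if_neg hci]
      conv_rhs => rw [hsub]
      rw [coeff_mul_add_eq_of_natDegree_le (by omega) (natDegree_le_vecNatDegree (M i) j)]
      rfl
  have := Fintype.linearIndependent_iff.1 h _ hz i₀
  rw [if_neg hi₀', hN, Nat.add_sub_cancel] at this
  exact hi₀' (leadingCoeff_eq_zero.1 this)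

/-! ### Rational row spaces and Forney's criterion for minimal bases -/

section Rational

variable {p k : ℕ}

/-- A polynomial matrix viewed as a matrix of rational functions. -/
def ratMat (M : Matrix (Fin p) (Fin k) F[X]) : Matrix (Fin p) (Fin k) (RatFunc F) :=
  M.map (algebraMap F[X] (RatFunc F))

/-- The rational row space of a polynomial matrix. -/
def rowSpace (M : Matrix (Fin p) (Fin k) F[X]) : Submodule (RatFunc F) (Fin k → RatFunc F) :=
  Submodule.span (RatFunc F) (Set.range (ratMat M).row)

theorem toRat_injective {ι : Type*} : Function.Injective (toRat : (ι → F[X]) → ι → RatFunc F) :=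
  fun _ _ h => funext fun i => IsFractionRing.injective F[X] (RatFunc F) (congrFun h i)

theorem toRat_vecMul (c : Fin p → F[X]) (M : Matrix (Fin p) (Fin k) F[X]) :
    toRat (c ᵥ* M) = toRat c ᵥ* ratMat M :=
  funext fun j => RingHom.map_vecMul (algebraMap F[X] (RatFunc F)) M c j

theorem toRat_smul {ι : Type*} (q : F[X]) (v : ι → F[X]) :
    toRat (q • v) = algebraMap F[X] (RatFunc F) q • toRat v := by
  funext i
  simp [toRat]

theorem span_row_eq_range {K : Type*} [Field K] (M : Matrix (Fin p) (Fin k) K) :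
    Submodule.span K (Set.range M.row) = LinearMap.range M.vecMulLinear := by
  apply le_antisymm
  · rw [Submodule.span_le]
    rintro _ ⟨i, rfl⟩
    exact ⟨Pi.single i 1, by simp [Matrix.row]⟩
  · rintro _ ⟨x, rfl⟩
    rw [Matrix.vecMulLinear_apply, Matrix.vecMul_eq_sum]
    exact Submodule.sum_mem _ fun i _ => Submodule.smul_mem _ _ (Submodule.subset_span ⟨i, rfl⟩)

theorem mem_rowSpace {M : Matrix (Fin p) (Fin k) F[X]} {w : Fin k → RatFunc F} :
    w ∈ rowSpace M ↔ ∃ x, x ᵥ* ratMat M = w := by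
  rw [rowSpace, span_row_eq_range]
  rfl

theorem isPolynomialBasis_row_iff {M : Matrix (Fin p) (Fin k) F[X]}
    {V : Submodule (RatFunc F) (Fin k → RatFunc F)} :
    IsPolynomialBasis V M.row ↔ LinearIndependent (RatFunc F) (ratMat M).row ∧ rowSpace M = V :=
  ⟨fun h => ⟨h.1, h.2⟩, fun h => ⟨h.1, h.2⟩⟩

/-- Multiplication by an invertible rational matrix preserves being a basis. -/
theorem isPolynomialBasis_of_eq_mul {M N : Matrix (Fin p) (Fin k) F[X]}
    {V : Submodule (RatFunc F) (Fin k → RatFunc F)} (hM : IsPolynomialBasis V M.row)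
    {W : Matrix (Fin p) (Fin p) (RatFunc F)} (hW : IsUnit W) (h : ratMat N = W * ratMat M) :
    IsPolynomialBasis V N.row := by
  rw [isPolynomialBasis_row_iff] at hM ⊢
  obtain ⟨hli, rfl⟩ := hM
  rw [← Matrix.vecMul_injective_iff] at hli ⊢
  constructor
  · intro x y hxy
    simp only [h, ← Matrix.vecMul_vecMul] at hxy
    exact Matrix.vecMul_injective_iff_isUnit.2 hW (hli hxy)
  · ext w
    rw [mem_rowSpace, mem_rowSpace]
    constructor
    · rintro ⟨x, rfl⟩
      exact ⟨x ᵥ* W, by rw [h, Matrix.vecMul_vecMul]⟩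
    · rintro ⟨x, rfl⟩
      obtain ⟨u, rfl⟩ := hW
      refine ⟨x ᵥ* (↑u⁻¹ : Matrix (Fin p) (Fin p) (RatFunc F)), ?_⟩
      rw [h, Matrix.vecMul_vecMul, ← Matrix.mul_assoc, Units.inv_mul, Matrix.one_mul]

theorem IsPolynomialBasis.ne_zero {b : Fin p → Fin k → F[X]}
    {V : Submodule (RatFunc F) (Fin k → RatFunc F)} (h : IsPolynomialBasis V b) (i : Fin p) :
    b i ≠ 0 := by
  intro h0
  refine h.linearIndependent.ne_zero i (funext fun j => ?_)
  simp [toRat, h0]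

theorem IsPolynomialBasis.sum_vecDegree {b : Fin p → Fin k → F[X]}
    {V : Submodule (RatFunc F) (Fin k → RatFunc F)} (h : IsPolynomialBasis V b) :
    ∑ i, vecDegree (b i) = ((∑ i, vecNatDegree (b i) : ℕ) : WithBot ℕ) := by
  push_cast
  exact Finset.sum_congr rfl fun i _ => vecDegree_eq_coe (h.ne_zero i)

/-- Basis vectors are nonzero, so no degree is `⊥`; in `ℕ`, common summands can be cancelled. -/
theorem isMinimalBasis_iff {b : Fin p → Fin k → F[X]}
    {V : Submodule (RatFunc F) (Fin k → RatFunc F)} :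
    IsMinimalBasis V b ↔ IsPolynomialBasis V b ∧ ∀ b' : Fin p → Fin k → F[X],
      IsPolynomialBasis V b' → ∑ i, vecNatDegree (b i) ≤ ∑ i, vecNatDegree (b' i) := by
  constructor
  · refine fun h => ⟨h.1, fun b' hb' => ?_⟩
    have := h.2 b' hb'
    rwa [h.1.sum_vecDegree, hb'.sum_vecDegree, Nat.cast_withBot, Nat.cast_withBot,
      WithBot.coe_le_coe] at this
  · refine fun h => ⟨h.1, fun b' hb' => ?_⟩
    have hle := h.2 b' hb'
    rw [h.1.sum_vecDegree, hb'.sum_vecDegree, Nat.cast_withBot, Nat.cast_withBot,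
      WithBot.coe_le_coe]
    exact hle

/-- In a minimal basis no element can be exchanged for one of smaller degree. -/
theorem RowsMinimalBasis.exchange {M : Matrix (Fin p) (Fin k) F[X]} (hM : RowsMinimalBasis M)
    {q : F[X]} (hq : q ≠ 0) {v : Fin k → F[X]} {c : Fin p → F[X]} (h : q • v = c ᵥ* M)
    {i : Fin p} (hi : c i ≠ 0) : v ≠ 0 ∧ vecNatDegree (M i) ≤ vecNatDegree v := by
  classical
  obtain ⟨hb, hmin⟩ := isMinimalBasis_iff.1 hM
  have hq' : algebraMap F[X] (RatFunc F) q ≠ 0 :=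
    (map_ne_zero_iff _ (IsFractionRing.injective F[X] (RatFunc F))).2 hq
  have hc' : algebraMap F[X] (RatFunc F) (c i) ≠ 0 :=
    (map_ne_zero_iff _ (IsFractionRing.injective F[X] (RatFunc F))).2 hi
  have hv : toRat v = ((algebraMap F[X] (RatFunc F) q)⁻¹ • toRat c) ᵥ* ratMat M := by
    rw [Matrix.smul_vecMul, ← toRat_vecMul, ← h, toRat_smul, inv_smul_smul₀ hq']
  have hb' : IsPolynomialBasis (rowSpace M) (M.updateRow i v).row := by
    -- The exchange is left multiplication by the identity with row `i` replaced by `c / q`, which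
    -- is invertible because its diagonal entry `c i / q` is nonzero.
    refine isPolynomialBasis_of_eq_mul hb (isUnit_updateRow_one i
      ((algebraMap F[X] (RatFunc F) q)⁻¹ • toRat c) ?_) ?_
    · exact (mul_ne_zero (inv_ne_zero hq') hc').isUnit
    · ext1 i' j
      by_cases hii : i' = i
      · subst hii
        have := congrFun hv j
        simpa [ratMat, Matrix.mul_apply, Matrix.vecMul, dotProduct, toRat] using this
      · rw [Matrix.mul_apply]
        simp [ratMat, Matrix.updateRow_ne hii, Matrix.one_apply]
  refine ⟨by simpa [Matrix.row] using hb'.ne_zero i, ?_⟩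
  have hle := hmin _ hb'
  rw [← Finset.add_sum_erase _ _ (Finset.mem_univ i),
    ← Finset.add_sum_erase Finset.univ (fun x => vecNatDegree ((M.updateRow i v).row x))
      (Finset.mem_univ i)] at hle
  have heq : ∑ x ∈ Finset.univ.erase i, vecNatDegree ((M.updateRow i v).row x) =
      ∑ x ∈ Finset.univ.erase i, vecNatDegree (M.row x) :=
    Finset.sum_congr rfl fun x hx => by
      simp [Matrix.row, Matrix.updateRow_ne (Finset.ne_of_mem_erase hx)]
  rw [heq, add_le_add_iff_right] at hle
  simpa [Matrix.row] using hle

/-- A minimal basis is row reduced. -/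
theorem RowsMinimalBasis.rowReduced {M : Matrix (Fin p) (Fin k) F[X]}
    (hM : RowsMinimalBasis M) : RowReduced M := by
  classical
  by_contra hnot
  rw [RowReduced, Fintype.not_linearIndependent_iff] at hnot
  obtain ⟨a, ha, i₁, hi₁⟩ := hnot
  obtain ⟨i₀, hi₀, hmax⟩ := (Finset.univ.filter fun i => a i ≠ 0).exists_max_image
    (fun i => vecNatDegree (M i)) ⟨i₁, by simpa using hi₁⟩
  simp only [Finset.mem_filter, Finset.mem_univ, true_and] at hi₀ hmax
  set N := vecNatDegree (M i₀) with hN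
  -- Powers of `X` lift every row in the dependence to degree `N`, so that the relation `a` cancels
  -- the leading terms; exchanging row `i₀` then lowers the degree sum.
  let c : Fin p → F[X] := fun i => C (a i) * X ^ (N - vecNatDegree (M i))
  obtain ⟨hv, hle⟩ := hM.exchange (q := 1) one_ne_zero (v := c ᵥ* M) (c := c) (one_smul _ _)
    (i := i₀) (by simpa [c] using hi₀)
  have hdeg : ∀ j i, (c i * M i j).natDegree ≤ N := by
    intro j i
    by_cases hai : a i = 0
    · simp [c, hai]
    · have := hmax i hai
      refine natDegree_mul_le.trans ?_
      have h1 : (c i).natDegree ≤ N - vecNatDegree (M i) := natDegree_C_mul_X_pow_le _ _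
      have h2 := natDegree_le_vecNatDegree (M i) j
      omega
  have hcoeff : ∀ j, ((c ᵥ* M) j).coeff N = 0 := by
    intro j
    have := congrFun ha j
    rw [Finset.sum_apply, Pi.zero_apply] at this
    rw [Matrix.vecMul, dotProduct, finsetSum_coeff, ← this]
    refine Finset.sum_congr rfl fun i _ => ?_
    by_cases hai : a i = 0
    · simp [c, hai]
    · have hle := hmax i hai
      have hsub : N = (N - vecNatDegree (M i)) + vecNatDegree (M i) := by omega
      conv_lhs => rw [hsub]
      rw [coeff_mul_add_eq_of_natDegree_le (natDegree_C_mul_X_pow_le _ _)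
        (natDegree_le_vecNatDegree (M i) j)]
      simp [rowCoeff, Matrix.row]
  -- Stated with `vecDegree` to cover `N = 0`, where the strict bound would force the vector to be
  -- zero.
  have hlt : vecDegree (c ᵥ* M) < (N : WithBot ℕ) := by
    refine (Finset.sup_lt_iff (WithBot.bot_lt_coe N)).2 fun j _ => ?_
    have hj : ((c ᵥ* M) j).natDegree ≤ N := by
      rw [Matrix.vecMul, dotProduct]
      exact natDegree_sum_le_of_forall_le _ _ fun i _ => hdeg j i
    have hj' : ((c ᵥ* M) j).degree ≤ (N : WithBot ℕ) := natDegree_le_iff_degree_le.1 hj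
    refine lt_of_le_of_ne hj' fun h => ?_
    exact coeff_ne_zero_of_eq_degree h (hcoeff j)
  rw [vecDegree_eq_coe hv, Nat.cast_withBot, Nat.cast_withBot, WithBot.coe_lt_coe] at hlt
  omega

/-- Every polynomial vector in the rational row space is a polynomial combination of rows. -/
def RowSaturated (M : Matrix (Fin p) (Fin k) F[X]) : Prop :=
  ∀ v : Fin k → F[X], toRat v ∈ rowSpace M → ∃ c : Fin p → F[X], c ᵥ* M = v

theorem exists_smul_eq_vecMul {M : Matrix (Fin p) (Fin k) F[X]} {v : Fin k → F[X]}
    (hv : toRat v ∈ rowSpace M) : ∃ (q : F[X]) (c : Fin p → F[X]), q ≠ 0 ∧ q • v = c ᵥ* M := by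
  obtain ⟨x, hx⟩ := mem_rowSpace.1 hv
  obtain ⟨⟨q, hq⟩, h⟩ := IsLocalization.exist_integer_multiples_of_finite (nonZeroDivisors F[X]) x
  choose c hc using h
  refine ⟨q, c, nonZeroDivisors.ne_zero hq, toRat_injective ?_⟩
  rw [toRat_smul, toRat_vecMul, ← hx, ← Matrix.smul_vecMul]
  congr 1
  funext i
  simpa [toRat, Algebra.smul_def] using (hc i).symm

/-- A minimal basis generates all polynomial vectors of the space it spans. -/
theorem RowsMinimalBasis.rowSaturated {M : Matrix (Fin p) (Fin k) F[X]}
    (hM : RowsMinimalBasis M) : RowSaturated M := by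
  classical
  intro v hv
  obtain ⟨q, c, hq, h⟩ := exists_smul_eq_vecMul hv
  -- Coefficients are reduced modulo the denominator `q`. A nonzero remainder would give a
  -- polynomial vector of degree below that of row `i₀`, which it could replace.
  let c₁ : Fin p → F[X] := fun i => c i / q
  let c₂ : Fin p → F[X] := fun i => c i % q
  have hc : c = q • c₁ + c₂ := funext fun i => (EuclideanDomain.div_add_mod (c i) q).symm
  have hv' : q • (v - c₁ ᵥ* M) = c₂ ᵥ* M := by
    rw [smul_sub, h, ← Matrix.smul_vecMul, ← Matrix.sub_vecMul, hc, add_sub_cancel_left]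
  by_cases h0 : c₂ = 0
  · rw [h0, Matrix.zero_vecMul, smul_eq_zero_iff_right hq, sub_eq_zero] at hv'
    exact ⟨c₁, hv'.symm⟩
  exfalso
  obtain ⟨i₁, hi₁⟩ := Function.ne_iff.1 h0
  obtain ⟨i₀, hi₀, hmax⟩ := (Finset.univ.filter fun i => c₂ i ≠ 0).exists_max_image
    (fun i => vecNatDegree (M i)) ⟨i₁, by simpa using hi₁⟩
  simp only [Finset.mem_filter, Finset.mem_univ, true_and] at hi₀ hmax
  obtain ⟨hne, hle⟩ := hM.exchange hq hv' hi₀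
  set w := v - c₁ ᵥ* M with hw
  have hlt : ∀ j, (w j).degree < (vecNatDegree (M i₀) : WithBot ℕ) := by
    intro j
    have hqw : (q * w j).degree < q.degree + (vecNatDegree (M i₀) : WithBot ℕ) := by
      have : q * w j = ∑ i, c₂ i * M i j := congrFun hv' j
      rw [this]
      have hbot : (⊥ : WithBot ℕ) < q.degree + (vecNatDegree (M i₀) : WithBot ℕ) := by
        rw [degree_eq_natDegree hq, ← WithBot.coe_natCast, ← WithBot.coe_natCast, ← WithBot.coe_add]
        exact WithBot.bot_lt_coe _
      refine (degree_sum_le _ _).trans_lt ((Finset.sup_lt_iff hbot).2 fun i _ => ?_)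
      by_cases hi : c₂ i = 0
      · simpa [hi] using hbot
      rw [degree_mul]
      have h1 : (c₂ i).degree < q.degree := Polynomial.degree_mod_lt _ hq
      have h2 : (M i j).degree ≤ (vecNatDegree (M i₀) : WithBot ℕ) :=
        natDegree_le_iff_degree_le.1 ((natDegree_le_vecNatDegree (M i) j).trans (hmax i hi))
      exact (add_le_add le_rfl h2).trans_lt
        (WithBot.add_lt_add_of_lt_of_le WithBot.coe_ne_bot h1 le_rfl)
    rw [degree_mul] at hqw
    exact lt_of_add_lt_add_left hqw
  have hlt' : vecDegree w < (vecNatDegree (M i₀) : WithBot ℕ) := by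
    exact (Finset.sup_lt_iff (WithBot.bot_lt_coe _)).2 fun j _ => hlt j
  rw [vecDegree_eq_coe hne, Nat.cast_withBot, Nat.cast_withBot, WithBot.coe_lt_coe] at hlt'
  omega

theorem vecMul_injective_of_ratMat {M : Matrix (Fin p) (Fin k) F[X]}
    (h : LinearIndependent (RatFunc F) (ratMat M).row) :
    Function.Injective fun c : Fin p → F[X] => c ᵥ* M := by
  intro c c' hcc
  apply toRat_injective
  apply Matrix.vecMul_injective_iff.2 h
  simp only [← toRat_vecMul]
  exact congrArg toRat hcc

/-- A minimal basis, as a matrix of rows, has a polynomial right inverse. -/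
theorem RowsMinimalBasis.exists_rightInverse {M : Matrix (Fin p) (Fin k) F[X]}
    (hM : RowsMinimalBasis M) : ∃ G : Matrix (Fin k) (Fin p) F[X], M * G = 1 := by
  classical
  have hsat := hM.rowSaturated
  have hinj := vecMul_injective_of_ratMat (isPolynomialBasis_row_iff.1 hM.isBasis).1
  let f := M.vecMulLinear
  let Q := (Fin k → F[X]) ⧸ LinearMap.range f
  -- Saturation says that the quotient by the row module is torsion free. Over the principal ideal
  -- domain `F[X]` it is therefore free, so the inclusion of the row module splits, and the
  -- retraction is the right inverse.
  have htf : Module.IsTorsionFree F[X] Q := by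
    refine Module.IsTorsionFree.of_smul_eq_zero fun q x hx => ?_
    by_contra! hcon
    obtain ⟨hq, hx0⟩ := hcon
    obtain ⟨v, rfl⟩ := Submodule.mkQ_surjective _ x
    rw [← map_smul, Submodule.mkQ_apply, Submodule.Quotient.mk_eq_zero] at hx
    obtain ⟨c, hc⟩ := hx
    refine hx0 ((Submodule.Quotient.mk_eq_zero _).2 ?_)
    have hq' : algebraMap F[X] (RatFunc F) q ≠ 0 :=
      (map_ne_zero_iff _ (IsFractionRing.injective F[X] (RatFunc F))).2 hq
    obtain ⟨c', hc'⟩ := hsat v (mem_rowSpace.2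
      ⟨(algebraMap F[X] (RatFunc F) q)⁻¹ • toRat c, by
        rw [Matrix.smul_vecMul, ← toRat_vecMul, show c ᵥ* M = q • v from hc, toRat_smul,
          inv_smul_smul₀ hq']⟩)
    exact ⟨c', hc'⟩
  have hfree : Module.Free F[X] Q := Module.free_of_finite_type_torsion_free'
  have hsurj := Submodule.mkQ_surjective (LinearMap.range f)
  obtain ⟨s, hs⟩ := Module.projective_lifting_property (LinearMap.range f).mkQ
    (LinearMap.id : Q →ₗ[F[X]] Q) hsurj
  have hexact : Function.Exact f (LinearMap.range f).mkQ :=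
    LinearMap.exact_iff.2 (Submodule.ker_mkQ _)
  have hsplit : (∃ l, (LinearMap.range f).mkQ ∘ₗ l = LinearMap.id) ↔ ∃ l, l ∘ₗ f = LinearMap.id :=
    (hexact.split_tfae hinj hsurj).out 0 1
  obtain ⟨g, hg⟩ := hsplit.1 ⟨s, hs⟩
  refine ⟨(LinearMap.toMatrix' g)ᵀ, ?_⟩
  ext1 i j
  have h1 : g (M i) = Pi.single i 1 := by
    have := LinearMap.congr_fun hg (Pi.single i 1)
    simpa [f, Matrix.row] using this
  have h2 := congrFun (LinearMap.toMatrix'_mulVec g (M i)) j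
  rw [h1] at h2
  rw [Matrix.mul_apply, Matrix.one_apply]
  simp only [Matrix.mulVec, dotProduct] at h2
  rw [Pi.single_apply] at h2
  simpa [mul_comm, eq_comm] using h2

/-- Rational coordinates `x` of `v` satisfy `x = v ᵥ* G`, hence are polynomial. -/
theorem rowSaturated_of_mul_eq_one {M : Matrix (Fin p) (Fin k) F[X]}
    {G : Matrix (Fin k) (Fin p) F[X]} (h : M * G = 1) : RowSaturated M := by
  intro v hv
  obtain ⟨x, hx⟩ := mem_rowSpace.1 hv
  have hx' : x = toRat (v ᵥ* G) := by
    rw [toRat_vecMul, ← hx, Matrix.vecMul_vecMul, ratMat, ratMat, ← Matrix.map_mul, h]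
    simp
  refine ⟨v ᵥ* G, toRat_injective ?_⟩
  rw [toRat_vecMul, ← hx', hx]

theorem linearIndependent_row_of_mul_eq_one {K : Type*} [Field K] {M : Matrix (Fin p) (Fin k) K}
    {G : Matrix (Fin k) (Fin p) K} (h : M * G = 1) : LinearIndependent K M.row := by
  rw [← Matrix.vecMul_injective_iff]
  intro x y hxy
  have := congrArg (· ᵥ* G) hxy
  simpa [Matrix.vecMul_vecMul, h] using this

theorem exists_rightInverse_of_linearIndependent_row {K : Type*} [Field K]
    {M : Matrix (Fin p) (Fin k) K} (h : LinearIndependent K M.row) :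
    ∃ G : Matrix (Fin k) (Fin p) K, M * G = 1 := by
  rw [← Matrix.mulVec_surjective_iff_exists_right_inverse]
  have hr := h.rank_matrix
  rw [Fintype.card_fin] at hr
  have : LinearMap.range M.mulVecLin = ⊤ :=
    Submodule.eq_top_of_finrank_eq (by rw [← Matrix.rank, hr]; simp)
  exact LinearMap.range_eq_top.1 this

/-- Some term of the Leibniz expansion is nonzero. It pairs each row of a row reduced matrix with a
vector of another basis that involves it. -/
theorem exists_perm_ne_zero_of_det_ne_zero {S : Type*} [CommRing S] {C : Matrix (Fin p) (Fin p) S}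
    (h : C.det ≠ 0) : ∃ σ : Equiv.Perm (Fin p), ∀ i, C (σ i) i ≠ 0 := by
  by_contra! hcon
  refine h ?_
  rw [Matrix.det_apply]
  refine Finset.sum_eq_zero fun σ _ => ?_
  obtain ⟨i, hi⟩ := hcon σ
  have : ∏ i, C (σ i) i = 0 := Finset.prod_eq_zero (Finset.mem_univ i) hi
  rw [this, smul_zero]

/-- A row reduced matrix with a polynomial right inverse has rows forming a minimal basis. -/
theorem RowReduced.rowsMinimalBasis {M : Matrix (Fin p) (Fin k) F[X]} (hred : RowReduced M)
    {G : Matrix (Fin k) (Fin p) F[X]} (h : M * G = 1) : RowsMinimalBasis M := by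
  refine isMinimalBasis_iff.2 ⟨isPolynomialBasis_row_iff.2 ⟨?_, rfl⟩, fun b' hb' => ?_⟩
  · refine linearIndependent_row_of_mul_eq_one (G := ratMat G) ?_
    rw [ratMat, ratMat, ← Matrix.map_mul, h]
    simp
  have hsat := rowSaturated_of_mul_eq_one h
  have hmem : ∀ i, toRat (b' i) ∈ rowSpace M := fun i => by
    have := Submodule.subset_span (R := RatFunc F)
      (Set.mem_range_self (f := fun i => toRat (b' i)) i)
    rwa [hb'.span_eq] at this
  choose C hC using fun i => hsat (b' i) (hmem i)
  have hdet : (Matrix.of C).det ≠ 0 := by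
    intro h0
    obtain ⟨x, hx0, hx⟩ := Matrix.exists_vecMul_eq_zero_iff.2 h0
    refine hx0 (vecMul_injective_of_ratMat (M := Matrix.of b') hb'.linearIndependent ?_)
    have : Matrix.of b' = Matrix.of C * M := by
      ext1 i j
      rw [Matrix.mul_apply]
      exact (congrFun (hC i) j).symm
    simp only [this, ← Matrix.vecMul_vecMul, hx, Matrix.zero_vecMul]
  obtain ⟨σ, hσ⟩ := exists_perm_ne_zero_of_det_ne_zero hdet
  rw [← Equiv.sum_comp σ fun i => vecNatDegree (b' i)]
  refine Finset.sum_le_sum fun i _ => ?_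
  -- By predictable degree, the basis vector paired with row `i` has at least the degree of that
  -- row.
  have := hred.natDegree_add_le (C (σ i)) i (hσ i)
  rw [hC] at this
  exact (Nat.le_add_left _ _).trans this

/-- Every rational space with a polynomial basis has a minimal basis. -/
theorem IsPolynomialBasis.exists_isMinimalBasis {b : Fin p → Fin k → F[X]}
    {V : Submodule (RatFunc F) (Fin k → RatFunc F)} (h : IsPolynomialBasis V b) :
    ∃ M : Matrix (Fin p) (Fin k) F[X], rowSpace M = V ∧ RowsMinimalBasis M := by
  let s : Set (Fin p → Fin k → F[X]) := {b | IsPolynomialBasis V b}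
  let f : (Fin p → Fin k → F[X]) → ℕ := fun b => ∑ i, vecNatDegree (b i)
  have hs : s.Nonempty := ⟨b, h⟩
  have hmem : IsPolynomialBasis V (Function.argminOn f s hs) := Function.argminOn_mem f s hs
  refine ⟨Matrix.of (Function.argminOn f s hs), hmem.span_eq, ?_⟩
  have hV : Submodule.span (RatFunc F)
      (Set.range fun i => toRat ((Matrix.of (Function.argminOn f s hs)).row i)) = V := hmem.span_eq
  rw [RowsMinimalBasis, hV]
  exact isMinimalBasis_iff.2 ⟨hmem, fun b' hb' => Function.argminOn_le f s hb'⟩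

/-- Some rows of `Q` already form a polynomial basis of its row space, so a basis of least degree
sum exists. -/
theorem exists_rowsMinimalBasis_rowSpace (Q : Matrix (Fin p) (Fin k) F[X]) :
    ∃ M : Matrix (Fin (normalRank Q)) (Fin k) F[X], rowSpace M = rowSpace Q ∧
      RowsMinimalBasis M := by
  have hr : Module.finrank (RatFunc F) (rowSpace Q) = normalRank Q :=
    (Matrix.rank_eq_finrank_span_row (ratMat Q)).symm
  obtain ⟨f, hf, hspan, hli⟩ := Submodule.exists_fun_fin_finrank_span_eq (RatFunc F)
    (Set.range (ratMat Q).row)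
  choose g hg using hf
  have hb : IsPolynomialBasis (rowSpace Q) fun i => Q (g i) := by
    have hfun : (fun i => toRat (Q (g i))) = f := funext hg
    exact ⟨hfun ▸ hli, hfun ▸ hspan⟩
  change IsPolynomialBasis (p := Module.finrank (RatFunc F) (rowSpace Q)) _ _ at hb
  rw [← hr]
  exact hb.exists_isMinimalBasis

end Rational

/-! ### Rank criteria and the two implications -/

theorem le_rank_of_mul_mul_eq_one {K : Type*} [Field K] {m n r : ℕ}
    {A : Matrix (Fin r) (Fin m) K} {P : Matrix (Fin m) (Fin n) K} {B : Matrix (Fin n) (Fin r) K}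
    (h : A * P * B = 1) : r ≤ P.rank := by
  have h1 : (A * P * B).rank = r := by rw [h, Matrix.rank_one, Fintype.card_fin]
  rw [← h1]
  exact (Matrix.rank_mul_le_left _ _).trans (Matrix.rank_mul_le_right _ _)

theorem le_rank_map_of_mul_mul_eq_one {S K : Type*} [CommRing S] [Field K] (f : S →+* K)
    {m n r : ℕ} {A : Matrix (Fin r) (Fin m) S} {P : Matrix (Fin m) (Fin n) S}
    {B : Matrix (Fin n) (Fin r) S} (h : A * P * B = 1) : r ≤ (P.map f).rank := by
  refine le_rank_of_mul_mul_eq_one (A := A.map f) (B := B.map f) ?_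
  rw [← Matrix.map_mul, ← Matrix.map_mul, h]
  simp

theorem aeval_zero_eq_algebraMap_eval (p : F[X]) :
    aeval (0 : AlgebraicClosure F) p = algebraMap F (AlgebraicClosure F) (p.eval 0) := by
  rw [← map_zero (algebraMap F (AlgebraicClosure F)), aeval_algebraMap_apply]
  rfl

/-- Without infinite eigenvalues, the coefficient matrix of degree `d` has the normal rank. -/
theorem rank_map_coeff_eq_normalRank {m n d : ℕ} {P : Matrix (Fin m) (Fin n) F[X]}
    (hP : matDegree P ≤ d) (h : ¬ HasInfiniteEigenvalue d P) :
    (P.map fun p => p.coeff d).rank = normalRank P := by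
  obtain ⟨e, he⟩ := exists_isInvariantPolynomials (reversal d P)
  rw [← reversal_map_evalRingHom_zero, ← normalRank_reversal hP]
  refine he.matEquiv.rank_map_of_ne_zero _ (normalRank_le_height _) (normalRank_le_width _)
    fun j hj => h ⟨_, e, he, j, ?_⟩
  rw [aeval_zero_eq_algebraMap_eval, show (e j).eval 0 = 0 from hj, map_zero]

theorem not_hasInfiniteEigenvalue {m n d : ℕ} {P : Matrix (Fin m) (Fin n) F[X]}
    (hP : matDegree P ≤ d) (h : normalRank P ≤ (P.map fun p => p.coeff d).rank) :
    ¬ HasInfiniteEigenvalue d P := by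
  rintro ⟨r, e, he, j, hj⟩
  rw [aeval_zero_eq_algebraMap_eval, FaithfulSMul.algebraMap_eq_zero_iff] at hj
  refine he.map_ne_zero (evalRingHom 0) ?_ j hj
  rwa [reversal_map_evalRingHom_zero, ← he.rank_eq, normalRank_reversal hP]

theorem exists_factorization {m n d r : ℕ} {P : Matrix (Fin m) (Fin n) F[X]}
    (hP : matDegree P ≤ d) (hr : normalRank P = r) (hfin : ∀ β, ¬ IsFiniteEigenvalue P β)
    (hinf : ¬ HasInfiniteEigenvalue d P) :
    ∃ (L : Matrix (Fin m) (Fin r) F[X]) (R : Matrix (Fin r) (Fin n) F[X]),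
      P = L * R ∧ ColumnsMinimalBasis L ∧ RowsMinimalBasis R ∧
      ∀ i, vecDegree (L.col i) + vecDegree (R.row i) = (d : WithBot ℕ) := by
  obtain ⟨A, B, hAB⟩ := exists_mul_mul_eq_one hr hfin
  have hrT : normalRank Pᵀ = r := by
    rw [← hr, normalRank, Matrix.transpose_map, Matrix.rank_transpose, normalRank]
  obtain ⟨N, hN, hmin⟩ : ∃ N : Matrix (Fin r) (Fin m) F[X],
      rowSpace N = rowSpace Pᵀ ∧ RowsMinimalBasis N := hrT ▸ exists_rowsMinimalBasis_rowSpace Pᵀ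
  have hmem : ∀ j, toRat (Pᵀ j) ∈ rowSpace N := fun j => by
    rw [hN]
    exact Submodule.subset_span ⟨j, rfl⟩
  choose c hc using fun j => hmin.rowSaturated (Pᵀ j) (hmem j)
  let R : Matrix (Fin r) (Fin n) F[X] := (Matrix.of c)ᵀ
  have hPLR : P = Nᵀ * R := by
    ext1 a j
    rw [Matrix.mul_apply, ← Matrix.transpose_apply P, ← hc]
    simp [Matrix.vecMul, dotProduct, R, mul_comm]
  -- `A * Nᵀ` and `R * B` are square of size `r` with product `1`, so they commute.
  have hRinv : R * (B * (A * Nᵀ)) = 1 := by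
    have h1 : (A * Nᵀ) * (R * B) = 1 := by
      rw [← hAB, hPLR]
      simp only [Matrix.mul_assoc]
    rw [← Matrix.mul_assoc]
    exact mul_eq_one_comm.1 h1
  have hred := hmin.rowReduced
  -- Column `j` of `P` is the combination of the rows of `N` with coefficients `c j`; predictable
  -- degree bounds each nonzero coefficient.
  have hdeg : ∀ i j, R i j ≠ 0 → (R i j).natDegree + vecNatDegree (N i) ≤ d := by
    intro i j hij
    have := hred.natDegree_add_le (c j) i hij
    rw [hc] at this
    exact this.trans (vecNatDegree_le fun a => natDegree_le_of_matDegree_le hP a j)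
  have hRne : ∀ i, R i ≠ 0 := by
    intro i h0
    have := congrFun (congrFun hRinv i) i
    rw [Matrix.mul_apply] at this
    simp [h0] at this
  have hle : ∀ i, vecNatDegree (N i) ≤ d := by
    intro i
    obtain ⟨j, hj⟩ := Function.ne_iff.1 (hRne i)
    have := hdeg i j hj
    omega
  have hRle : ∀ i j, (R i j).natDegree ≤ d - vecNatDegree (N i) := by
    intro i j
    by_cases hij : R i j = 0
    · simp [hij]
    · have := hdeg i j hij
      omega
  have hcoeff := map_coeff_mul (L := Nᵀ) (k := fun i => vecNatDegree (N i))
    (fun a i => natDegree_le_vecNatDegree (N i) a) hRle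
    (fun i => Nat.add_sub_cancel' (hle i))
  rw [← hPLR] at hcoeff
  set Rh := rowCoeff R fun i => d - vecNatDegree (N i) with hRh
  -- The coefficient matrix of `λ^d` has rank `r`, having no eigenvalue at infinity to lower it, and
  -- `Rh` is a right factor of it with only `r` rows.
  have hRhli : LinearIndependent F Rh.row := by
    rw [linearIndependent_iff_card_le_finrank_span, Set.finrank, ← Matrix.rank_eq_finrank_span_row,
      Fintype.card_fin]
    refine (hr.symm.trans (rank_map_coeff_eq_normalRank hP hinf).symm).trans_le ?_
    rw [hcoeff]
    exact Matrix.rank_mul_le_right _ _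
  have hRdeg : ∀ i, vecNatDegree (R i) = d - vecNatDegree (N i) := by
    intro i
    refine le_antisymm (vecNatDegree_le (hRle i)) ?_
    obtain ⟨j, hj⟩ := Function.ne_iff.1 (hRhli.ne_zero i)
    exact (le_natDegree_of_ne_zero hj).trans (natDegree_le_vecNatDegree (R i) j)
  have hRred : RowReduced R := by
    rw [RowReduced, show (fun i => vecNatDegree (R i)) = fun i => d - vecNatDegree (N i) from
      funext hRdeg]
    exact hRhli
  refine ⟨Nᵀ, R, hPLR, hmin, hRred.rowsMinimalBasis hRinv, fun i => ?_⟩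
  change vecDegree (N i) + vecDegree (R i) = _
  rw [vecDegree_eq_coe (hred.row_ne_zero i), vecDegree_eq_coe (hRne i), hRdeg, ← Nat.cast_add,
    Nat.add_sub_cancel' (hle i)]

theorem of_factorization {m n d r : ℕ} {P : Matrix (Fin m) (Fin n) F[X]}
    (hP : matDegree P ≤ d) (hr0 : 0 < r) {L : Matrix (Fin m) (Fin r) F[X]}
    {R : Matrix (Fin r) (Fin n) F[X]} (hPLR : P = L * R) (hL : ColumnsMinimalBasis L)
    (hR : RowsMinimalBasis R)
    (hd : ∀ i, vecDegree (L.col i) + vecDegree (R.row i) = (d : WithBot ℕ)) :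
    normalRank P = r ∧ matDegree P = (d : WithBot ℕ) ∧ (∀ β, ¬ IsFiniteEigenvalue P β) ∧
      ¬ HasInfiniteEigenvalue d P := by
  have hLt : RowsMinimalBasis Lᵀ := hL
  obtain ⟨S, hLS⟩ := hLt.exists_rightInverse
  obtain ⟨T, hRT⟩ := hR.exists_rightInverse
  have hinv : Sᵀ * P * T = 1 := by
    have hLS' : Sᵀ * L = 1 := by simpa using congrArg Matrix.transpose hLS
    rw [hPLR, ← Matrix.mul_assoc, hLS', Matrix.one_mul, hRT]
  have hrank : normalRank P = r := by
    refine le_antisymm ?_ (le_rank_map_of_mul_mul_eq_one _ hinv)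
    rw [hPLR, normalRank, Matrix.map_mul]
    exact (Matrix.rank_mul_le_left _ _).trans (Matrix.rank_le_width _)
  have hLred := hLt.rowReduced
  have hRred := hR.rowReduced
  have hkl : ∀ i, vecNatDegree (Lᵀ i) + vecNatDegree (R i) = d := by
    intro i
    have : vecDegree (Lᵀ i) + vecDegree (R i) = (d : WithBot ℕ) := hd i
    rw [vecDegree_eq_coe (hLred.row_ne_zero i), vecDegree_eq_coe (hRred.row_ne_zero i)] at this
    exact_mod_cast this
  have hcoeff := map_coeff_mul (L := L) (R := R) (fun a i => natDegree_le_vecNatDegree (Lᵀ i) a)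
    (fun i b => natDegree_le_vecNatDegree (R i) b) hkl
  obtain ⟨HL, hHL⟩ := exists_rightInverse_of_linearIndependent_row hLred
  obtain ⟨HR, hHR⟩ := exists_rightInverse_of_linearIndependent_row hRred
  have hcr : r ≤ (P.map fun p => p.coeff d).rank := by
    refine le_rank_of_mul_mul_eq_one (A := HLᵀ) (B := HR) ?_
    rw [hPLR, hcoeff, ← Matrix.mul_assoc, ← Matrix.transpose_mul, hHL, Matrix.transpose_one,
      Matrix.one_mul, hHR]
  refine ⟨hrank, le_antisymm hP ?_, ?_, not_hasInfiniteEigenvalue hP (hrank.trans_le hcr)⟩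
  -- A smaller degree would make the coefficient matrix of `λ^d` zero, against its rank being at
  -- least `r > 0`.
  · by_contra hlt
    have h0 : (P.map fun p => p.coeff d) = 0 := by
      ext i j
      refine coeff_eq_zero_of_degree_lt (lt_of_le_of_lt ?_ (not_le.1 hlt))
      exact (Finset.le_sup (f := fun j => (P i j).degree) (Finset.mem_univ j)).trans
        (Finset.le_sup (f := fun i => Finset.univ.sup fun j => (P i j).degree) (Finset.mem_univ i))
    rw [h0, Matrix.rank_zero] at hcr
    omega
  · rintro β ⟨r', e, he, j, hj⟩
    -- The identity `Sᵀ * P * T = 1` evaluated at `β` keeps the rank of `P(β)` at least `r`.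
    refine he.map_ne_zero (aeval β : F[X] →ₐ[F] AlgebraicClosure F).toRingHom ?_ j hj
    rw [← he.rank_eq, hrank]
    exact le_rank_map_of_mul_mul_eq_one _ hinv

end PolyMat

end

theorem mainTheorem1 {F : Type*} [Field F] {m n : ℕ} (d r : ℕ)
    (P : Matrix (Fin m) (Fin n) (Polynomial F))
    (hP : PolyMat.matDegree P ≤ (d : WithBot ℕ))
    (hr0 : 0 < r) (hr : r ≤ min m n) :
    (PolyMat.normalRank P = r ∧
      PolyMat.matDegree P = (d : WithBot ℕ) ∧
      (∀ β : AlgebraicClosure F, ¬ PolyMat.IsFiniteEigenvalue P β) ∧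
      ¬ PolyMat.HasInfiniteEigenvalue d P) ↔
    ∃ (L : Matrix (Fin m) (Fin r) (Polynomial F)) (R : Matrix (Fin r) (Fin n) (Polynomial F)),
      P = L * R ∧
      PolyMat.ColumnsMinimalBasis L ∧
      PolyMat.RowsMinimalBasis R ∧
      ∀ i : Fin r,
        PolyMat.vecDegree (L.col i) + PolyMat.vecDegree (R.row i) = (d : WithBot ℕ) := by
  constructor
  · rintro ⟨hrank, -, hfin, hinf⟩
    exact PolyMat.exists_factorization hP hrank hfin hinf
  · rintro ⟨L, R, hPLR, hL, hR, hd⟩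
    exact PolyMat.of_factorization hP hr0 hPLR hL hR hd
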